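/- Let $\mathcal X$ be a Polish space and $\mathcal Y\subseteq\mathbb R$ a closed subset. Let $L:\mathcal X\times\mathcal Y\times\mathbb R\to[0,\infty)$ be continuous with $L(x,y,y)=0$ for all $(x,y)\in\mathcal X\times\mathcal Y$, such that $t\mapsto L(x,y,t)$ is convex for every $(x,y)$, and such that for some constant $|L|_1\in(0,\infty)$ $$\sup_{(x,y)\in\mathcal X\times\mathcal Y}|L(x,y,t)-L(x,y,t')|\le |L|_1\,|t-t'|\qquad\text{for all }t,t'\in\mathbb R .$$ Let $k:\mathcal X\times\mathcal X\to\mathbb R$ be a bounded and continuous kernel with reproducing kernel Hilbert space $H$, let $\lambda\in(0,\infty)$ and let $n\ge 1$ be an integer. For a data set $D_n=((x_1,y_1),\dots,(x_n,y_n))\in(\mathcal X\times\mathcal Y)^n$ consider the problem of minimizing $$\frac1n\sum_{i=1}^n L(x_i,y_i,f(x_i))+\lambda\|f\|_H^2\qquad\text{over } f\in H .$$ Then for every $D_n\in(\mathcal X\times\mathcal Y)^n$ this problem has exactly one solution $f_{L,D_n,\lambda}\in H$, and the SVM-estimator $$(\mathcal X\times\mathcal Y)^n\to H,\qquad D_n\mapsto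 f_{L,D_n,\lambda},$$ is continuous with respect to the product topology on $(\mathcal X\times\mathcal Y)^n$ and the norm topology on $H$; hence it is measurable with respect to the Borel $\sigma$-algebras. That is, the problem is well-posed in Hadamard's sense: a solution exists, is unique, and depends continuously on the data $D_n$. -/

import Mathlib

open Set

/-- A data set `D = ((x₁, y₁), …, (xₙ, yₙ)) ∈ (X × Y)ⁿ`. -/
abbrev DataSet (X : Type*) (Y : Set ℝ) (n : ℕ) : Type _ := Fin n → X × Y

/-- The real-valued function `k` is the reproducing kernel of the Hilbert space `H` of real
functions on `X`. (Mathlib's `RKHS.kernel H x x'` is a linear map `ℝ → ℝ`; its value at `1` is the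
scalar kernel. Symmetry and positive semidefiniteness of `k` follow.) -/
def IsKernelOf {X : Type*} (H : Type*) [NormedAddCommGroup H] [InnerProductSpace ℝ H]
    [CompleteSpace H] [RKHS ℝ H X ℝ] (k : X → X → ℝ) : Prop :=
  ∀ x x' : X, k x x' = RKHS.kernel H x x' 1

/-- A continuous convex Lipschitz loss function `L : X × Y × ℝ → [0, ∞)` which vanishes when the
prediction equals the observed value. -/
structure IsContinuousConvexLipschitzLoss {X : Type*} [TopologicalSpace X] {Y : Set ℝ}
    (L : X → Y → ℝ → ℝ) : Prop where
  continuous : Continuous fun p : X × Y × ℝ => L p.1 p.2.1 p.2.2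
  nonneg : ∀ x y t, 0 ≤ L x y t
  eq_zero : ∀ (x : X) (y : Y), L x y (y : ℝ) = 0
  convex : ∀ x y, ConvexOn ℝ univ (L x y)
  lipschitz : ∃ c : ℝ, 0 < c ∧ ∀ t t' : ℝ, ∀ x y, |L x y t - L x y t'| ≤ c * |t - t'|

section SVM

variable {X : Type*} {Y : Set ℝ} {H : Type*} [NormedAddCommGroup H] [InnerProductSpace ℝ H]
  [RKHS ℝ H X ℝ] {n : ℕ}

/-- The regularized empirical risk `(1/n) ∑ᵢ L(xᵢ, yᵢ, f(xᵢ)) + lam ‖f‖²` of `f ∈ H`. -/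
noncomputable def empRegRisk (L : X → Y → ℝ → ℝ) (lam : ℝ) (D : DataSet X Y n) (f : H) : ℝ :=
  (1 / (n : ℝ)) * ∑ i, L (D i).1 (D i).2 (f (D i).1) + lam * ‖f‖ ^ 2

/-- `f` is an empirical support vector machine for the data set `D`: it minimizes the regularized
empirical risk in `H`. -/
def IsEmpiricalSVM (L : X → Y → ℝ → ℝ) (lam : ℝ) (D : DataSet X Y n) (f : H) : Prop :=
  ∀ g : H, empRegRisk L lam D f ≤ empRegRisk L lam D g

open Classical in
/-- The SVM-estimator: it maps a data set `D` to a minimizer of the regularized empirical risk in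
`H` (with the irrelevant value `0` if there were no minimizer). -/
noncomputable def svmEstimator (H : Type*) [NormedAddCommGroup H] [InnerProductSpace ℝ H]
    [RKHS ℝ H X ℝ] (L : X → Y → ℝ → ℝ) (lam : ℝ) (n : ℕ) (D : DataSet X Y n) : H :=
  if h : ∃ f : H, IsEmpiricalSVM L lam D f then h.choose else 0

end SVM

/-- Well-posedness in Hadamard's sense of the problem "given the datum `a`, find `s` with
`Sol a s`": a solution exists, it is unique, and it depends continuously on the datum. -/
structure HadamardWellPosed {A S : Type*} [TopologicalSpace A] [TopologicalSpace S]
    (Sol : A → S → Prop) : Prop where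
  exists_sol : ∀ a, ∃ s, Sol a s
  unique_sol : ∀ a s s', Sol a s → Sol a s' → s = s'
  continuous_sol : ∀ F : A → S, (∀ a, Sol a (F a)) → Continuous F

open Filter Topology

/-! By the parallelogram law, `lam * ‖f‖ ^ 2` makes the risk `R_D` strongly midpoint convex. Hence
minimizing sequences are Cauchy, the minimizer is unique, and any `g` exceeds the minimum by at
least `lam / 2` times its squared distance to the minimizer (`mul_norm_sub_sq_le`). Using this bound
for `D` and for `D'`, each tested at the other's minimizer, and adding gives `lam * ‖F D' - F D‖ ^ 2
≤ (R_D (F D') - R_D' (F D')) + (R_D' (F D) - R_D (F D))`. The second bracket vanishes as `D' → D` by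
continuity in the data. In the first the predictor moves too, so the convergence must be uniform on
bounded sets of predictors. -/

/-- A continuous function on a complete space which is bounded below and satisfies a quantitative
midpoint convexity inequality attains its minimum. -/
lemma exists_forall_le_of_midpoint_strongly_convex {H : Type*} [NormedAddCommGroup H]
    [NormedSpace ℝ H] [CompleteSpace H] {R : H → ℝ} {c : ℝ} (hc : 0 < c) (hR : Continuous R)
    (hbdd : BddBelow (range R))
    (hmid : ∀ f g, R ((1 / 2 : ℝ) • (f + g)) + c * ‖f - g‖ ^ 2 ≤ (R f + R g) / 2) :
    ∃ f, ∀ g, R f ≤ R g := by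
  have hinf : ∀ g, ⨅ f, R f ≤ R g := fun g => ciInf_le hbdd g
  have hex : ∀ m : ℕ, ∃ f, R f < (⨅ f, R f) + 1 / ((m : ℝ) + 1) := fun m =>
    exists_lt_of_ciInf_lt (lt_add_of_pos_right _ Nat.one_div_pos_of_nat)
  choose u hu using hex
  have hlim : Tendsto (fun m : ℕ => √(1 / ((m : ℝ) + 1) / c)) atTop (𝓝 0) := by
    have h := (tendsto_one_div_add_atTop_nhds_zero_nat (𝕜 := ℝ)).div_const c
    simpa using h.sqrt
  have hcauchy : CauchySeq u := by
    refine cauchySeq_of_le_tendsto_0 _ (fun p q N hp hq => ?_) hlim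
    rw [dist_eq_norm]
    apply Real.le_sqrt_of_sq_le
    rw [le_div_iff₀ hc]
    have h1 := hmid (u p) (u q)
    have h2 := hinf ((1 / 2 : ℝ) • (u p + u q))
    have h3 : 1 / ((p : ℝ) + 1) ≤ 1 / ((N : ℝ) + 1) := Nat.one_div_le_one_div hp
    have h4 : 1 / ((q : ℝ) + 1) ≤ 1 / ((N : ℝ) + 1) := Nat.one_div_le_one_div hq
    -- The midpoint has value at least the infimum, while both endpoints lie within `1 / (N + 1)` of
    -- it.
    linarith [hu p, hu q]
  obtain ⟨f, hf⟩ := cauchySeq_tendsto_of_complete hcauchy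
  refine ⟨f, fun g => le_trans ?_ (hinf g)⟩
  have hright : Tendsto (fun m : ℕ => (⨅ f, R f) + 1 / ((m : ℝ) + 1)) atTop (𝓝 (⨅ f, R f)) := by
    simpa using (tendsto_one_div_add_atTop_nhds_zero_nat (𝕜 := ℝ)).const_add (⨅ f, R f)
  exact le_of_tendsto_of_tendsto' ((hR.tendsto f).comp hf) hright fun m => (hu m).le

section FeatureMap

variable {X : Type*} {H : Type*} [NormedAddCommGroup H] [InnerProductSpace ℝ H] [CompleteSpace H]
  [RKHS ℝ H X ℝ]

lemma apply_eq_inner_kerFun_one (f : H) (x : X) : f x = inner ℝ f (RKHS.kerFun H x 1) := by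
  simp

lemma IsKernelOf.eq_inner {k : X → X → ℝ} (hH : IsKernelOf H k) (x x' : X) :
    k x x' = inner ℝ (RKHS.kerFun H x (1 : ℝ)) (RKHS.kerFun H x' (1 : ℝ)) := by
  rw [hH x x', ← RKHS.kerFun_apply, apply_eq_inner_kerFun_one, real_inner_comm]

/-- The feature map of a continuous kernel is continuous. -/
lemma IsKernelOf.continuous_kerFun_one [TopologicalSpace X] {k : X → X → ℝ}
    (hH : IsKernelOf H k) (hk : Continuous fun p : X × X => k p.1 p.2) :
    Continuous fun x : X => RKHS.kerFun H x (1 : ℝ) := by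
  rw [continuous_iff_continuousAt]
  intro x
  rw [ContinuousAt, tendsto_iff_norm_sub_tendsto_zero]
  -- Expanding the squared norm turns feature distance into kernel values.
  have hdist : ∀ x' : X, ‖RKHS.kerFun H x' (1 : ℝ) - RKHS.kerFun H x (1 : ℝ)‖ =
      √(k x' x' - 2 * k x' x + k x x) := by
    intro x'
    rw [hH.eq_inner, hH.eq_inner, hH.eq_inner, real_inner_self_eq_norm_sq,
      real_inner_self_eq_norm_sq, ← norm_sub_sq_real, Real.sqrt_sq (norm_nonneg _)]
  simp_rw [hdist]
  have hcont : Continuous fun x' : X => √(k x' x' - 2 * k x' x + k x x) :=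
    (((hk.comp (continuous_id.prodMk continuous_id)).sub
      ((hk.comp (continuous_id.prodMk continuous_const)).const_mul 2)).add
        continuous_const).sqrt
  have h0 : √(k x x - 2 * k x x + k x x) = 0 := by
    rw [show k x x - 2 * k x x + k x x = 0 by ring, Real.sqrt_zero]
  simpa only [h0] using hcont.tendsto x

end FeatureMap

namespace IsContinuousConvexLipschitzLoss

variable {X : Type*} [TopologicalSpace X] {Y : Set ℝ} {L : X → Y → ℝ → ℝ}
  {H : Type*} [NormedAddCommGroup H] [InnerProductSpace ℝ H] [RKHS ℝ H X ℝ]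
  {lam : ℝ} {n : ℕ}

lemma loss_midpoint_le (hL : IsContinuousConvexLipschitzLoss L) (x : X) (y : Y) (s t : ℝ) :
    L x y (1 / 2 * (s + t)) ≤ (L x y s + L x y t) / 2 := by
  have h := (hL.convex x y).2 (mem_univ s) (mem_univ t)
    (by norm_num : (0 : ℝ) ≤ 1 / 2) (by norm_num : (0 : ℝ) ≤ 1 / 2) (by norm_num)
  simp only [smul_eq_mul] at h
  rw [mul_add]
  linarith

lemma continuous_loss (hL : IsContinuousConvexLipschitzLoss L) {A : Type*} [TopologicalSpace A]
    {z : A → X × Y} {t : A → ℝ} (hz : Continuous z) (ht : Continuous t) :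
    Continuous fun a => L (z a).1 (z a).2 (t a) :=
  hL.continuous.comp (hz.fst.prodMk (hz.snd.prodMk ht))

lemma continuous_empRegRisk (hL : IsContinuousConvexLipschitzLoss L) (D : DataSet X Y n) :
    Continuous (empRegRisk L lam D : H → ℝ) := by
  unfold empRegRisk
  refine ((continuous_finsetSum _ fun i _ => ?_).const_mul _).add
    ((continuous_norm.pow 2).const_mul _)
  exact hL.continuous_loss continuous_const (RKHS.continuous_eval _)

lemma mul_norm_sq_le_empRegRisk (hL : IsContinuousConvexLipschitzLoss L) (D : DataSet X Y n)
    (f : H) : lam * ‖f‖ ^ 2 ≤ empRegRisk L lam D f :=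
  le_add_of_nonneg_left
    (mul_nonneg (by positivity) (Finset.sum_nonneg fun _ _ => hL.nonneg _ _ _))

/-- Strong midpoint convexity of the regularized empirical risk. -/
lemma empRegRisk_midpoint_le (hL : IsContinuousConvexLipschitzLoss L) (D : DataSet X Y n)
    (f g : H) :
    empRegRisk L lam D ((1 / 2 : ℝ) • (f + g)) + lam / 4 * ‖f - g‖ ^ 2 ≤
      (empRegRisk L lam D f + empRegRisk L lam D g) / 2 := by
  have hsum : ∑ i, L (D i).1 (D i).2 (((1 / 2 : ℝ) • (f + g) : H) (D i).1) ≤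
      (∑ i, L (D i).1 (D i).2 (f (D i).1) + ∑ i, L (D i).1 (D i).2 (g (D i).1)) / 2 := by
    rw [← Finset.sum_add_distrib, Finset.sum_div]
    refine Finset.sum_le_sum fun i _ => ?_
    rw [RKHS.coe_smul, RKHS.coe_add]
    exact hL.loss_midpoint_le _ _ _ _
  have hn : (0 : ℝ) ≤ 1 / n := by positivity
  have hnorm : ‖(1 / 2 : ℝ) • (f + g)‖ ^ 2 = (‖f‖ ^ 2 + ‖g‖ ^ 2) / 2 - ‖f - g‖ ^ 2 / 4 := by
    rw [norm_smul, mul_pow, Real.norm_of_nonneg (by norm_num)]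
    have := parallelogram_law_with_norm ℝ f g
    linarith
  unfold empRegRisk
  rw [hnorm]
  have := mul_le_mul_of_nonneg_left hsum hn
  linarith

/-- The midpoint of `f` and `g` cannot have smaller risk than the minimizer `f`; doubling the
midpoint inequality turns `lam / 4` into `lam / 2`. -/
lemma mul_norm_sub_sq_le (hL : IsContinuousConvexLipschitzLoss L) {D : DataSet X Y n}
    {f : H} (hf : IsEmpiricalSVM L lam D f) (g : H) :
    lam / 2 * ‖f - g‖ ^ 2 ≤ empRegRisk L lam D g - empRegRisk L lam D f := by
  have := hL.empRegRisk_midpoint_le (lam := lam) D f g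
  have := hf ((1 / 2 : ℝ) • (f + g))
  linarith

lemma isEmpiricalSVM_unique (hL : IsContinuousConvexLipschitzLoss L) (hlam : 0 < lam)
    {D : DataSet X Y n} {f g : H} (hf : IsEmpiricalSVM L lam D f)
    (hg : IsEmpiricalSVM L lam D g) : f = g := by
  have h1 := hL.mul_norm_sub_sq_le hf g
  have h2 : ‖f - g‖ ^ 2 ≤ 0 := by
    refine nonpos_of_mul_nonpos_right (a := lam / 2) ?_ (half_pos hlam)
    linarith [hg f]
  exact sub_eq_zero.1 (norm_eq_zero.1 (pow_eq_zero_iff two_ne_zero |>.1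
    (le_antisymm h2 (sq_nonneg _))))

lemma exists_isEmpiricalSVM [CompleteSpace H] (hL : IsContinuousConvexLipschitzLoss L)
    (hlam : 0 < lam) (D : DataSet X Y n) : ∃ f : H, IsEmpiricalSVM L lam D f := by
  refine exists_forall_le_of_midpoint_strongly_convex (by positivity : 0 < lam / 4)
    (hL.continuous_empRegRisk D) ⟨0, ?_⟩ (hL.empRegRisk_midpoint_le D)
  rintro _ ⟨f, rfl⟩
  exact (by positivity : 0 ≤ lam * ‖f‖ ^ 2).trans (hL.mul_norm_sq_le_empRegRisk D f)

lemma isEmpiricalSVM_svmEstimator [CompleteSpace H] (hL : IsContinuousConvexLipschitzLoss L)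
    (hlam : 0 < lam) (D : DataSet X Y n) : IsEmpiricalSVM L lam D (svmEstimator H L lam n D) := by
  have h : ∃ f : H, IsEmpiricalSVM L lam D f := hL.exists_isEmpiricalSVM hlam D
  rw [svmEstimator, dif_pos h]
  exact h.choose_spec

variable [CompleteSpace H] {k : X → X → ℝ}

lemma continuous_empRegRisk_data (hL : IsContinuousConvexLipschitzLoss L)
    (hH : IsKernelOf H k) (hk : Continuous fun p : X × X => k p.1 p.2) (f : H) :
    Continuous fun D : DataSet X Y n => empRegRisk L lam D f := by
  unfold empRegRisk
  refine ((continuous_finsetSum _ fun i _ => ?_).const_mul _).add continuous_const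
  refine hL.continuous_loss (continuous_apply i) ?_
  simp_rw [apply_eq_inner_kerFun_one f]
  exact continuous_const.inner ((hH.continuous_kerFun_one hk).comp (continuous_apply i).fst)

/-- Along bounded predictors, moving the data point changes the loss by an amount which vanishes
in the limit. -/
lemma tendsto_loss_sub_loss (hL : IsContinuousConvexLipschitzLoss L)
    (hH : IsKernelOf H k) (hk : Continuous fun p : X × X => k p.1 p.2) {ι : Type*} {l : Filter ι}
    {z : X × Y} {w : ι → X × Y} (hw : Tendsto w l (𝓝 z)) {f : ι → H} {B : ℝ}
    (hf : ∀ᶠ a in l, ‖f a‖ ≤ B) :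
    Tendsto (fun a => L z.1 z.2 (f a z.1) - L (w a).1 (w a).2 (f a (w a).1)) l (𝓝 0) := by
  obtain ⟨c, hc, hlip⟩ := hL.lipschitz
  -- Predictions at `z.1` stay in a fixed compact interval by Cauchy–Schwarz, over which continuity
  -- of the loss in the data point is uniform.
  have hdata : Tendsto (fun a => L (w a).1 (w a).2 (f a z.1) - L z.1 z.2 (f a z.1)) l (𝓝 0) := by
    rw [Metric.tendsto_nhds]
    intro ε hε
    obtain ⟨v, hv, hvK⟩ := (isCompact_Icc (a := -(B * ‖RKHS.kerFun H z.1 (1 : ℝ)‖))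
      (b := B * ‖RKHS.kerFun H z.1 (1 : ℝ)‖)).mem_uniformity_of_prod
        (f := fun (p : X × Y) t => L p.1 p.2 t) (s := univ)
        (hL.continuous_loss continuous_fst continuous_snd).continuousOn (mem_univ z)
        (Metric.dist_mem_uniformity hε)
    rw [nhdsWithin_univ] at hv
    filter_upwards [hf, hw hv] with a ha hav
    have hmem : f a z.1 ∈ Icc (-(B * ‖RKHS.kerFun H z.1 (1 : ℝ)‖))
        (B * ‖RKHS.kerFun H z.1 (1 : ℝ)‖) := by
      rw [mem_Icc, ← abs_le, apply_eq_inner_kerFun_one]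
      exact (abs_real_inner_le_norm _ _).trans
        (mul_le_mul_of_nonneg_right ha (norm_nonneg _))
    simpa [Real.dist_eq] using hvK _ hav _ hmem
  -- The Lipschitz bound reduces this to continuity of the feature map, uniformly over `‖f a‖ ≤ B`.
  have hpred : Tendsto (fun a => L (w a).1 (w a).2 (f a z.1) - L (w a).1 (w a).2 (f a (w a).1))
      l (𝓝 0) := by
    have hfeat : Tendsto (fun a => c * (B * ‖RKHS.kerFun H z.1 (1 : ℝ) -
        RKHS.kerFun H (w a).1 (1 : ℝ)‖)) l (𝓝 0) := by
      have h : Continuous fun p : X × Y => c * (B * ‖RKHS.kerFun H z.1 (1 : ℝ) -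
          RKHS.kerFun H p.1 (1 : ℝ)‖) :=
        ((continuous_const.sub
          ((hH.continuous_kerFun_one hk).comp continuous_fst)).norm.const_mul B).const_mul c
      simpa [Function.comp_def] using (h.tendsto z).comp hw
    refine squeeze_zero_norm' ?_ hfeat
    filter_upwards [hf] with a ha
    rw [Real.norm_eq_abs]
    refine (hlip _ _ _ _).trans (mul_le_mul_of_nonneg_left ?_ hc.le)
    rw [apply_eq_inner_kerFun_one, apply_eq_inner_kerFun_one, ← inner_sub_right]
    exact (abs_real_inner_le_norm _ _).trans (mul_le_mul_of_nonneg_right ha (norm_nonneg _))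
  simpa using hpred.sub hdata

lemma tendsto_empRegRisk_sub_empRegRisk (hL : IsContinuousConvexLipschitzLoss L)
    (hH : IsKernelOf H k) (hk : Continuous fun p : X × X => k p.1 p.2) {D : DataSet X Y n}
    {F : DataSet X Y n → H} {B : ℝ} (hF : ∀ᶠ D' in 𝓝 D, ‖F D'‖ ≤ B) :
    Tendsto (fun D' => empRegRisk L lam D (F D') - empRegRisk L lam D' (F D')) (𝓝 D) (𝓝 0) := by
  have h := (tendsto_finsetSum Finset.univ fun i _ => hL.tendsto_loss_sub_loss hH hk
    ((continuous_apply i).tendsto D) hF).const_mul (1 / (n : ℝ))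
  simp only [Finset.sum_const_zero, mul_zero, Finset.sum_sub_distrib] at h
  refine h.congr fun D' => ?_
  unfold empRegRisk
  ring

/-- A minimizer does no worse than the zero predictor, whose risk is continuous in the data; the `+
1` is slack for nearby data sets. -/
lemma eventually_norm_le_of_isEmpiricalSVM (hL : IsContinuousConvexLipschitzLoss L)
    (hlam : 0 < lam) (hH : IsKernelOf H k) (hk : Continuous fun p : X × X => k p.1 p.2)
    {F : DataSet X Y n → H} (hF : ∀ D, IsEmpiricalSVM L lam D (F D)) (D : DataSet X Y n) :
    ∀ᶠ D' in 𝓝 D, ‖F D'‖ ≤ √((empRegRisk L lam D (0 : H) + 1) / lam) := by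
  have hcont := hL.continuous_empRegRisk_data (n := n) (lam := lam) hH hk (0 : H)
  filter_upwards [hcont.continuousAt.eventually_lt_const (lt_add_one _)] with D' hD'
  apply Real.le_sqrt_of_sq_le
  rw [le_div_iff₀ hlam, mul_comm]
  exact ((hL.mul_norm_sq_le_empRegRisk D' (F D')).trans (hF D' 0)).trans hD'.le

/-- Empirical support vector machines depend continuously on the data set. -/
theorem continuous_of_isEmpiricalSVM (hL : IsContinuousConvexLipschitzLoss L)
    (hlam : 0 < lam) (hH : IsKernelOf H k) (hk : Continuous fun p : X × X => k p.1 p.2)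
    {F : DataSet X Y n → H} (hF : ∀ D, IsEmpiricalSVM L lam D (F D)) : Continuous F := by
  rw [continuous_iff_continuousAt]
  intro D
  rw [ContinuousAt, tendsto_iff_norm_sub_tendsto_zero]
  have h1 := hL.tendsto_empRegRisk_sub_empRegRisk (lam := lam) hH hk
    (hL.eventually_norm_le_of_isEmpiricalSVM hlam hH hk hF D)
  have h2 := ((hL.continuous_empRegRisk_data (n := n) (lam := lam) hH hk (F D)).tendsto D).sub_const
    (empRegRisk L lam D (F D))
  have h3 := ((h1.add h2).div_const lam).sqrt
  simp only [sub_self, add_zero, zero_div, Real.sqrt_zero] at h3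
  refine squeeze_zero (fun _ => norm_nonneg _) (fun D' => ?_) h3
  apply Real.le_sqrt_of_sq_le
  rw [le_div_iff₀ hlam]
  have h4 := hL.mul_norm_sub_sq_le (hF D) (F D')
  have h5 := hL.mul_norm_sub_sq_le (hF D') (F D)
  rw [norm_sub_rev] at h4
  linarith

end IsContinuousConvexLipschitzLoss

theorem corollary3p4 {X : Type*} [TopologicalSpace X] [PolishSpace X]
    (Y : Set ℝ) (hY : IsClosed Y)
    (L : X → Y → ℝ → ℝ) (hL : IsContinuousConvexLipschitzLoss L)
    (k : X → X → ℝ) (hk_cont : Continuous fun p : X × X => k p.1 p.2)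
    (hk_bdd : ∃ C : ℝ, ∀ x x', |k x x'| ≤ C)
    (H : Type*) [NormedAddCommGroup H] [InnerProductSpace ℝ H] [CompleteSpace H]
    [RKHS ℝ H X ℝ] (hH : IsKernelOf H k)
    (lam : ℝ) (hlam : 0 < lam) (n : ℕ) (hn : 1 ≤ n) :
    (∀ D : DataSet X Y n, ∃! f : H, IsEmpiricalSVM L lam D f) ∧
    (∀ D : DataSet X Y n, IsEmpiricalSVM L lam D (svmEstimator H L lam n D)) ∧
    Continuous (svmEstimator H L lam n : DataSet X Y n → H) ∧
    @Measurable (DataSet X Y n) H (borel (DataSet X Y n)) (borel H) (svmEstimator H L lam n) ∧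
    HadamardWellPosed (fun (D : DataSet X Y n) (f : H) => IsEmpiricalSVM L lam D f) := by
  have hsvm : ∀ D : DataSet X Y n, IsEmpiricalSVM L lam D (svmEstimator H L lam n D) :=
    hL.isEmpiricalSVM_svmEstimator hlam
  have hcont : Continuous (svmEstimator H L lam n : DataSet X Y n → H) :=
    hL.continuous_of_isEmpiricalSVM hlam hH hk_cont hsvm
  refine ⟨fun D => ⟨_, hsvm D, fun g hg => hL.isEmpiricalSVM_unique hlam hg (hsvm D)⟩, hsvm, hcont,
    hcont.borel_measurable, ?_, fun D f g => hL.isEmpiricalSVM_unique hlam, fun F hF =>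
      hL.continuous_of_isEmpiricalSVM hlam hH hk_cont hF⟩
  exact fun D => ⟨_, hsvm D⟩
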